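/- Let $p$ be a prime number, let $k$ be a field of characteristic $p$, and let $G$ be a locally profinite group (a locally compact, Hausdorff, totally disconnected topological group). For a locally compact, Hausdorff, totally disconnected space $X$ and a $k$-vector space $V$, let $V[[X]]$ denote the $k$-vector space of all compactly supported finitely additive $V$-valued measures defined on the open-closed subsets of $X$. It is functorial with respect to $k$-linear maps of $V$ and, by pushforward, with respect to continuous maps of $X$. There is a natural map $V[[X\times Y]]\to V[[X]][[Y]]$, taking $\nu$ to $\bigl(B\mapsto(A\mapsto\nu(A\times B))\bigr)$. A $G$-contramodule over $k$ is a $k$-vector space $P$ endowed with a $k$-linear map $\pi_P\colon P[[G]]\to P$ such that * the two maps $P[[G\times G]]\rightrightarrows P[[G]]$, one being the pushforward along the multiplication $G\times G\to G$ and the other being the composition $P[[G\times G]]\to P[[G]][[G]]\to P[[G]]$ of the natural map with the map induced by $\pi_P$, have equal compositions with $\pi_P$; and * $\pi_P$ takes the point measure concentrated at the unit element of $G$ with value $x$ to $x$, for every $x\in P$. Morphisms of $G$-contramodules are the $k$-linear maps $f\colon P\to Q$ commuting with the contraactions, i.e. $f\circ\pi_P=\pi_Q\circ f[[G]]$, where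 $f[[G]]\colon P[[G]]\to Q[[G]]$ is the map induced by $f$. Let $G\text{-contra}_k$ be the category of $G$-contramodules over $k$. For an abstract group $\Gamma$, let $\Gamma\text{-mod}_k$ be the category of $k$-vector spaces with a $k$-linear action of $\Gamma$. The forgetful functor $G\text{-contra}_k\to G\text{-mod}_k$ endows a $G$-contramodule $P$ with the action of $G$ for which $g(x)$ is the image under $\pi_P$ of the point measure concentrated at $g^{-1}$ with value $x$ (for $g\in G$, $x\in P$). Assume that $G$ has a compact open subgroup $H\subset G$ that is a (topologically) finitely generated pro-$p$ group. Then the forgetful functor $G\text{-contra}_k\to G\text{-mod}_k$ is fully faithful. Moreover, for any dense subgroup $G'\subset G$, the forgetful functor $G\text{-contra}_k\to G'\text{-mod}_k$ (the above functor followed by restriction of the action to $G'$) is fully faithful. -/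

import Mathlib

open CategoryTheory TopologicalSpace

universe w u v

noncomputable section

/-- For a `k`-module `V` and a topological space `X`, the `k`-module `V[[X]]` of all compactly
supported finitely additive `V`-valued measures defined on the open-closed subsets of `X`. -/
def FinMeasure (k : Type*) (X : Type*) (V : Type*) [Ring k] [TopologicalSpace X]
    [AddCommGroup V] [Module k V] : Submodule k (Clopens X → V) where
  carrier := {μ | (∀ U W : Clopens X, Disjoint U W → μ (U ⊔ W) = μ U + μ W) ∧
    ∃ K : Set X, IsCompact K ∧ ∀ U : Clopens X, Disjoint (U : Set X) K → μ U = 0}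
  zero_mem' := ⟨by simp, ∅, isCompact_empty, by simp⟩
  add_mem' := by
    rintro μ ν ⟨hμ, K, hK, hμK⟩ ⟨hν, L, hL, hνL⟩
    refine ⟨fun U W h => ?_, K ∪ L, hK.union hL, fun U h => ?_⟩
    · simp only [Pi.add_apply, hμ U W h, hν U W h]
      abel
    · rw [Set.disjoint_union_right] at h
      simp [hμK U h.1, hνL U h.2]
  smul_mem' := by
    rintro c μ ⟨hμ, K, hK, hμK⟩
    refine ⟨fun U W h => ?_, K, hK, fun U h => ?_⟩
    · simp only [Pi.smul_apply, hμ U W h, smul_add]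
    · simp [hμK U h]

namespace FinMeasure

section

variable {k : Type*} {X Y V W : Type*} [Ring k] [TopologicalSpace X] [TopologicalSpace Y]
  [AddCommGroup V] [Module k V] [AddCommGroup W] [Module k W]

theorem ext {μ ν : FinMeasure k X V} (h : ∀ U, μ.1 U = ν.1 U) : μ = ν :=
  Subtype.ext (funext h)

/-- The map `V[[X]] → W[[X]]` induced by a linear map `V → W`. -/
def map (f : V →ₗ[k] W) : FinMeasure k X V →ₗ[k] FinMeasure k X W where
  toFun μ := ⟨fun U => f (μ.1 U), fun U U' h => by simp only [μ.2.1 U U' h, f.map_add], by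
    obtain ⟨K, hK, h⟩ := μ.2.2
    exact ⟨K, hK, fun U hU => by simp only [h U hU, f.map_zero]⟩⟩
  map_add' μ ν := ext fun U => f.map_add _ _
  map_smul' c μ := ext fun U => f.map_smul _ _

/-- The preimage of an open-closed subset under a continuous map. -/
def preimage (f : C(X, Y)) (U : Clopens Y) : Clopens X :=
  ⟨f ⁻¹' U, U.isClopen.preimage f.continuous⟩

/-- The pushforward `V[[X]] → V[[Y]]` with respect to a continuous map `X → Y`. -/
def pushforward (f : C(X, Y)) : FinMeasure k X V →ₗ[k] FinMeasure k Y V where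
  toFun μ := ⟨fun U => μ.1 (preimage f U), fun U U' h => by
      rw [← μ.2.1 (preimage f U) (preimage f U')]
      · rfl
      · rw [← Clopens.coe_disjoint] at h ⊢
        exact h.preimage f, by
    obtain ⟨K, hK, h⟩ := μ.2.2
    refine ⟨f '' K, hK.image f.continuous, fun U hU => h _ ?_⟩
    rw [Set.disjoint_left] at hU ⊢
    exact fun x hx hxK => hU hx ⟨x, hxK, rfl⟩⟩
  map_add' _ _ := rfl
  map_smul' _ _ := rfl

/-- The natural map `V[[X × Y]] → V[[X]][[Y]]`, taking `ν` to the measure whose value on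
`B ⊆ Y` is the measure `A ↦ ν (A × B)` on `X`. -/
def curry : FinMeasure k (X × Y) V →ₗ[k] FinMeasure k Y (FinMeasure k X V) where
  toFun ν := ⟨fun B => ⟨fun A => ν.1 (A ×ˢ B), fun A A' h => by
      rw [← ν.2.1 (A ×ˢ B) (A' ×ˢ B)]
      · exact congrArg ν.1 (SetLike.coe_injective Set.union_prod)
      · rw [← Clopens.coe_disjoint] at h ⊢
        exact Set.disjoint_prod.2 (Or.inl h), by
      obtain ⟨K, hK, h⟩ := ν.2.2
      refine ⟨Prod.fst '' K, hK.image continuous_fst, fun A hA => h _ ?_⟩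
      rw [Set.disjoint_left] at hA ⊢
      exact fun x hx hxK => hA hx.1 ⟨x, hxK, rfl⟩⟩, fun B B' h => by
      refine ext fun A => ?_
      change ν.1 (A ×ˢ (B ⊔ B')) = ν.1 (A ×ˢ B) + ν.1 (A ×ˢ B')
      rw [← ν.2.1 (A ×ˢ B) (A ×ˢ B')]
      · exact congrArg ν.1 (SetLike.coe_injective Set.prod_union)
      · rw [← Clopens.coe_disjoint] at h ⊢
        exact Set.disjoint_prod.2 (Or.inr h), by
      obtain ⟨K, hK, h⟩ := ν.2.2
      refine ⟨Prod.snd '' K, hK.image continuous_snd, fun B hB => ext fun A => h _ ?_⟩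
      rw [Set.disjoint_left] at hB ⊢
      exact fun x hx hxK => hB hx.2 ⟨x, hxK, rfl⟩⟩
  map_add' _ _ := rfl
  map_smul' _ _ := rfl

open Classical in
/-- The map `V → V[[X]]` assigning to `v` the point measure concentrated at `x`
with the value `v`. -/
def point (k : Type*) {X V : Type*} [Ring k] [TopologicalSpace X]
    [AddCommGroup V] [Module k V] (x : X) : V →ₗ[k] FinMeasure k X V where
  toFun v := ⟨fun U => if x ∈ U then v else 0, fun U W h => by
      rw [← Clopens.coe_disjoint, Set.disjoint_left] at h
      have hx : x ∈ U → x ∉ W := fun hU hW => h hU hW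
      have hs : x ∈ U ⊔ W ↔ x ∈ U ∨ x ∈ W := Iff.rfl
      by_cases hU : x ∈ U <;> by_cases hW : x ∈ W <;> simp_all,
    {x}, isCompact_singleton, fun U hU => by
      rw [Set.disjoint_singleton_right] at hU
      exact if_neg hU⟩
  map_add' v v' := ext fun U => by
    change (if x ∈ U then v + v' else 0) = (if x ∈ U then v else 0) + (if x ∈ U then v' else 0)
    split_ifs <;> simp
  map_smul' c v := ext fun U => by
    change (if x ∈ U then c • v else 0) = c • (if x ∈ U then v else 0)
    split_ifs <;> simp

theorem point_apply_of_mem {x : X} {U : Clopens X} (h : x ∈ U) (v : V) :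
    (point k x v).1 U = v := if_pos h

theorem point_apply_of_notMem {x : X} {U : Clopens X} (h : x ∉ U) (v : V) :
    (point k x v).1 U = 0 := if_neg h

theorem pushforward_point (f : C(X, Y)) (x : X) (v : V) :
    pushforward f (point k x v) = point k (f x) v := rfl

theorem curry_point (x : X) (y : Y) (v : V) :
    curry (point k (x, y) v) = point k y (point k x v) := by
  refine ext fun B => ext fun A => ?_
  change (point k (x, y) v).1 (A ×ˢ B) = _
  by_cases hB : y ∈ B
  · rw [point_apply_of_mem hB]
    by_cases hA : x ∈ A
    · rw [point_apply_of_mem hA, point_apply_of_mem (Clopens.mem_prod.2 ⟨hA, hB⟩)]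
    · rw [point_apply_of_notMem hA, point_apply_of_notMem fun h => hA (Clopens.mem_prod.1 h).1]
  · rw [point_apply_of_notMem hB, point_apply_of_notMem fun h => hB (Clopens.mem_prod.1 h).2]
    rfl

theorem map_point (f : V →ₗ[k] W) (x : X) (v : V) :
    map f (point k x v) = point k x (f v) := by
  refine ext fun U => ?_
  change f ((point k x v).1 U) = _
  by_cases hU : x ∈ U
  · rw [point_apply_of_mem hU, point_apply_of_mem hU]
  · rw [point_apply_of_notMem hU, point_apply_of_notMem hU, f.map_zero]

end

end FinMeasure

/-- A `G`-contramodule over `k`: a `k`-module `V` with a `k`-linear contraaction map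
`π : V[[G]] → V` satisfying contraassociativity and contraunitality. -/
structure GContra (k : Type u) (G : Type v) [Field k] [Group G] [TopologicalSpace G]
    [IsTopologicalGroup G] where
  /-- the underlying vector space -/
  V : Type w
  [addCommGroup : AddCommGroup V]
  [module : Module k V]
  /-- the contraaction map -/
  π : FinMeasure k G V →ₗ[k] V
  contraassoc : ∀ ν : FinMeasure k (G × G) V,
    π (FinMeasure.pushforward ⟨fun g : G × G => g.1 * g.2, continuous_mul⟩ ν) =
      π (FinMeasure.map π (FinMeasure.curry ν))
  contraunit : ∀ x : V, π (FinMeasure.point k 1 x) = x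

namespace GContra

attribute [instance] addCommGroup module

variable {k : Type u} {G : Type v} [Field k] [Group G] [TopologicalSpace G]
  [IsTopologicalGroup G]

/-- A morphism of `G`-contramodules is a `k`-linear map commuting with the contraactions. -/
@[ext]
structure Hom (P Q : GContra.{w} k G) where
  /-- the underlying linear map -/
  toLin : P.V →ₗ[k] Q.V
  comm : ∀ μ : FinMeasure k G P.V, toLin (P.π μ) = Q.π (FinMeasure.map toLin μ)

/-- The category `G-contra_k` of `G`-contramodules over `k`. -/
instance : Category (GContra.{w} k G) where
  Hom P Q := Hom P Q
  id P := ⟨LinearMap.id, fun _ => rfl⟩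
  comp f g := ⟨g.toLin ∘ₗ f.toLin, fun μ => by
    rw [LinearMap.comp_apply, f.comm, g.comm]
    rfl⟩

/-- The underlying `G`-module of a `G`-contramodule: the element `g` takes `x` to the contraaction
of the point measure at `g⁻¹` with the value `x`. -/
def rep (P : GContra.{w} k G) : Representation k G P.V where
  toFun g := P.π ∘ₗ FinMeasure.point k g⁻¹
  map_one' := LinearMap.ext fun x => by
    rw [LinearMap.comp_apply, inv_one]
    exact P.contraunit x
  map_mul' g h := LinearMap.ext fun x => by
    have := P.contraassoc (FinMeasure.point k (h⁻¹, g⁻¹) x)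
    rw [FinMeasure.pushforward_point, FinMeasure.curry_point, FinMeasure.map_point] at this
    rw [LinearMap.comp_apply, mul_inv_rev]
    exact this

/-- The forgetful functor `G-contra_k ⥤ G-mod_k`. -/
def forget (k : Type u) (G : Type v) [Field k] [Group G] [TopologicalSpace G]
    [IsTopologicalGroup G] : GContra.{w} k G ⥤ Rep.{w} k G where
  obj P := Rep.of P.rep
  map {P Q} f := Rep.ofHom ⟨Hom.toLin f, fun g => LinearMap.ext fun x => by
    change (Hom.toLin f) (P.π _) = Q.π _
    rw [Hom.comm f, FinMeasure.map_point]⟩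

end GContra

/-- A profinite group is pro-`p` if the index of every open normal subgroup is a power of `p`. -/
structure IsProP (p : ℕ) (H : Type*) [Group H] [TopologicalSpace H] : Prop where
  isTopologicalGroup : IsTopologicalGroup H
  compactSpace : CompactSpace H
  t2Space : T2Space H
  totallyDisconnectedSpace : TotallyDisconnectedSpace H
  index_eq : ∀ N : Subgroup H, N.Normal → IsOpen (N : Set H) → ∃ n : ℕ, N.index = p ^ n

/-- A topological group is (topologically) finitely generated if some finite subset generates
a dense subgroup. -/
def IsTopFG (H : Type*) [Group H] [TopologicalSpace H] : Prop :=
  ∃ S : Finset H, Dense (Subgroup.closure (S : Set H) : Set H)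

end

/-! Faithfulness is immediate; the content is that a `k`-linear map f commuting with a dense
subgroup commutes with the contraactions.

Take first a compact group Γ, where measures are the linear functionals on locally constant
functions. The defect δ = f ∘ π_P − π_Q ∘ f[[Γ]] kills point measures at 1 and, for s in the dense
subgroup, turns right translation by s into the action of s⁻¹ on Q. Finite generation makes the
space of continuous homomorphisms Γ → k finite-dimensional, so a finite subset S of the dense
subgroup detects them. As nonzero smooth representations of a pro-p group in characteristic p have
nonzero fixed vectors, locally constant functions right-invariant under S are then constant
(`exists_finset_invariant_eq_const`). Dually, every measure is a point measure at 1 plus ∑ (s − 1)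
N_s μ with N_s linear (`exists_eq_point_add_sum`).

Hence δ = ∑ (s − 1) δ N_s, and a Nakayama argument (`GContra.eq_zero_of_eq_sum_rep_sub`) gives δ =
0: the operator A = ∑ (s − 1) ⊗ N_s is pointwise nilpotent on test functions, so θ = ∑ Aⁿ(e at 1)
exists, and applying π_Q ∘ δ[[Γ]] to θ = (e at 1) + Aθ leaves δ e = 0.

For general G, a compact support meets finitely many cosets Hg, with g chosen in the dense subgroup,
and right translation reduces each coset to H. -/

noncomputable section

/-! ### Integration of locally constant functions -/

namespace FinMeasure

section Integral

variable {k X Y V W T : Type*} [Field k] [TopologicalSpace X] [TopologicalSpace Y]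
  [AddCommGroup V] [Module k V] [AddCommGroup W] [Module k W]

/-- The preimage of a set under a locally constant function, as a clopen set. -/
def fiber (φ : LocallyConstant X T) (B : Set T) : Clopens X :=
  ⟨φ ⁻¹' B, ⟨⟨φ.isLocallyConstant Bᶜ⟩, φ.isLocallyConstant B⟩⟩

theorem mem_fiber {φ : LocallyConstant X T} {B : Set T} {x : X} : x ∈ fiber φ B ↔ φ x ∈ B :=
  Iff.rfl

theorem apply_congr (μ : FinMeasure k X V) {U U' : Clopens X} (h : ∀ x, x ∈ U ↔ x ∈ U') :
    μ.1 U = μ.1 U' :=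
  congrArg μ.1 (SetLike.ext h)

theorem apply_bot (μ : FinMeasure k X V) : μ.1 ⊥ = 0 := by
  simpa using μ.2.1 ⊥ ⊥ disjoint_bot_left

theorem apply_fiber_finset (μ : FinMeasure k X V) (φ : LocallyConstant X T) (B : Finset T) :
    μ.1 (fiber φ B) = ∑ t ∈ B, μ.1 (fiber φ {t}) := by
  classical
  induction B using Finset.induction_on with
  | empty =>
    rw [Finset.sum_empty, ← apply_bot μ]
    refine congrArg μ.1 (SetLike.ext fun x => ?_)
    rw [mem_fiber, Finset.coe_empty]
    exact Iff.rfl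
  | insert t B ht ih =>
    rw [Finset.sum_insert ht, ← ih, ← μ.2.1]
    · refine congrArg μ.1 (SetLike.ext fun x => ?_)
      rw [mem_fiber, Finset.coe_insert]
      exact Iff.rfl
    · rw [← Clopens.coe_disjoint]
      refine Disjoint.preimage φ (s := {t}) (t := ↑B) ?_
      simpa using ht

/-- The indicator function of a clopen set. -/
abbrev ind (k : Type*) [Field k] (U : Clopens X) : LocallyConstant X k :=
  LocallyConstant.charFn k U.isClopen

theorem ind_of_mem {U : Clopens X} {x : X} (h : x ∈ U) : ind k U x = 1 :=
  (LocallyConstant.charFn_eq_one k x U.isClopen).2 h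

theorem ind_of_notMem {U : Clopens X} {x : X} (h : x ∉ U) : ind k U x = 0 :=
  (LocallyConstant.charFn_eq_zero k x U.isClopen).2 h

variable [CompactSpace X]

theorem sum_fiber_eq_of_range_subset (μ : FinMeasure k X V) (φ : LocallyConstant X T) (ψ : T → k)
    (B : Finset T) (hB : ∀ x, φ x ∈ B) :
    ∑ t ∈ B, ψ t • μ.1 (fiber φ {t}) = ∑ t ∈ φ.range_finite.toFinset, ψ t • μ.1 (fiber φ {t}) := by
  refine (Finset.sum_subset (fun t ht => ?_) fun t _ ht => ?_).symm
  · obtain ⟨x, rfl⟩ := (Set.Finite.mem_toFinset _).1 ht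
    exact hB x
  · have : fiber φ {t} = ⊥ := SetLike.ext fun x =>
      ⟨fun h => (ht ((Set.Finite.mem_toFinset _).2 ⟨x, h⟩)).elim, fun h => h.elim⟩
    rw [this, apply_bot, smul_zero]

/-- Group the values of `φ` by their image under `ψ` and use finite additivity. This is what makes
the integral linear. -/
theorem sum_fiber_map (μ : FinMeasure k X V) (φ : LocallyConstant X T) (ψ : T → k) :
    ∑ c ∈ (φ.map ψ).range_finite.toFinset, c • μ.1 (fiber (φ.map ψ) {c}) =
      ∑ t ∈ φ.range_finite.toFinset, ψ t • μ.1 (fiber φ {t}) := by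
  classical
  rw [← Finset.sum_fiberwise_of_maps_to (s := φ.range_finite.toFinset)
    (t := (φ.map ψ).range_finite.toFinset) (g := ψ)]
  · refine Finset.sum_congr rfl fun c _ => ?_
    have : fiber (φ.map ψ) {c} = fiber φ ↑(φ.range_finite.toFinset.filter (ψ · = c)) :=
      SetLike.ext fun x => by simp [mem_fiber]
    rw [this, apply_fiber_finset, Finset.smul_sum]
    refine Finset.sum_congr rfl fun t ht => ?_
    rw [(Finset.mem_filter.1 ht).2]
  · intro t ht
    obtain ⟨x, rfl⟩ := (Set.Finite.mem_toFinset _).1 ht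
    exact (Set.Finite.mem_toFinset _).2 ⟨x, rfl⟩

/-- The integral of locally constant functions on a compact space with respect to a finitely
additive measure. -/
def integral (μ : FinMeasure k X V) : LocallyConstant X k →ₗ[k] V where
  toFun φ := ∑ c ∈ φ.range_finite.toFinset, c • μ.1 (fiber φ {c})
  map_add' φ φ' := by
    -- The level sets of the pair refine those of `φ`, `φ'` and `φ + φ'`, so all three integrals
    -- become sums over the values of `χ`.
    let χ : LocallyConstant X (k × k) := ⟨fun x => (φ x, φ' x),
      φ.isLocallyConstant.prodMk φ'.isLocallyConstant⟩
    have h := sum_fiber_map μ χ (fun t => t.1 + t.2)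
    simp only [add_smul, Finset.sum_add_distrib] at h
    rw [← sum_fiber_map μ χ Prod.fst, ← sum_fiber_map μ χ Prod.snd] at h
    exact h
  map_smul' a φ := by
    have h := sum_fiber_map μ φ (a • ·)
    simp only [smul_assoc, ← Finset.smul_sum] at h
    exact h

theorem integral_apply (μ : FinMeasure k X V) (φ : LocallyConstant X k) :
    integral μ φ = ∑ c ∈ φ.range_finite.toFinset, c • μ.1 (fiber φ {c}) := rfl

theorem integral_eq_sum (μ : FinMeasure k X V) (φ : LocallyConstant X k) (B : Finset k)
    (hB : ∀ x, φ x ∈ B) : integral μ φ = ∑ c ∈ B, c • μ.1 (fiber φ {c}) :=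
  (sum_fiber_eq_of_range_subset μ φ id B hB).symm

theorem integral_ind (μ : FinMeasure k X V) (U : Clopens X) : integral μ (ind k U) = μ.1 U := by
  classical
  rw [integral_eq_sum μ _ {0, 1}, Finset.sum_pair zero_ne_one, zero_smul, zero_add, one_smul]
  · exact congrArg μ.1 (SetLike.ext fun x => LocallyConstant.charFn_eq_one k x U.isClopen)
  · intro x
    by_cases h : x ∈ U
    · simp [ind_of_mem h]
    · simp [ind_of_notMem h]

theorem sum_ind_fiber (φ : LocallyConstant X k) :
    ∑ c ∈ φ.range_finite.toFinset, c • ind k (fiber φ {c}) = φ := by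
  classical
  refine LocallyConstant.ext fun x => ?_
  have : ∀ B : Finset k, (∑ c ∈ B, c • ind k (fiber φ {c})) x =
      ∑ c ∈ B, c * ind k (fiber φ {c}) x := fun B => by
    induction B using Finset.induction_on with
    | empty => rfl
    | insert a B ha ih => rw [Finset.sum_insert ha, Finset.sum_insert ha, ← ih]; rfl
  rw [this, Finset.sum_eq_single (φ x)]
  · rw [ind_of_mem (U := fiber φ {φ x}) rfl, mul_one]
  · intro c _ hc
    rw [ind_of_notMem (fun h => hc (mem_fiber.1 h).symm), mul_zero]
  · intro h
    exact (h ((Set.Finite.mem_toFinset _).2 ⟨x, rfl⟩)).elim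

/-- Linear functionals on locally constant functions are determined by their values on
indicators. -/
theorem integral_eq_of_ind (μ : FinMeasure k X V) (Λ : LocallyConstant X k →ₗ[k] V)
    (h : ∀ U, μ.1 U = Λ (ind k U)) : integral μ = Λ := by
  refine LinearMap.ext fun φ => ?_
  conv_rhs => rw [← sum_ind_fiber φ]
  rw [map_sum, integral_apply]
  refine Finset.sum_congr rfl fun c _ => ?_
  rw [map_smul, h]

/-- The measure on a compact space defined by a linear functional on locally constant functions. -/
def ofLinear (Λ : LocallyConstant X k →ₗ[k] V) : FinMeasure k X V :=
  ⟨fun U => Λ (ind k U), fun U U' h => by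
    rw [← map_add]
    refine congrArg Λ (LocallyConstant.ext fun x => ?_)
    rw [← Clopens.coe_disjoint, Set.disjoint_left] at h
    rw [LocallyConstant.coe_add, Pi.add_apply]
    by_cases hU : x ∈ U
    · rw [ind_of_mem (U := U ⊔ U') (Or.inl hU), ind_of_mem hU, ind_of_notMem (h hU), add_zero]
    · by_cases hU' : x ∈ U'
      · rw [ind_of_mem (U := U ⊔ U') (Or.inr hU'), ind_of_mem hU', ind_of_notMem hU, zero_add]
      · rw [ind_of_notMem (U := U ⊔ U') (fun h => h.elim hU hU'), ind_of_notMem hU',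
          ind_of_notMem hU, zero_add],
    Set.univ, isCompact_univ, fun U hU => by
      have : U = ⊥ := SetLike.coe_injective (by simpa using hU)
      rw [← map_zero Λ]
      refine congrArg Λ (LocallyConstant.ext fun x => ?_)
      rw [this]
      exact ind_of_notMem (fun h => h.elim)⟩

theorem integral_ofLinear (Λ : LocallyConstant X k →ₗ[k] V) : integral (ofLinear Λ) = Λ :=
  integral_eq_of_ind _ _ fun _ => rfl

/-- Measures on a compact space are the linear functionals on locally constant functions. -/
def equivLinear : FinMeasure k X V ≃ₗ[k] (LocallyConstant X k →ₗ[k] V) where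
  toFun := integral
  invFun := ofLinear
  map_add' μ ν := integral_eq_of_ind _ _ fun U => by
    rw [LinearMap.add_apply, integral_ind, integral_ind]; rfl
  map_smul' a μ := integral_eq_of_ind _ _ fun U => by
    rw [LinearMap.smul_apply, integral_ind]; rfl
  left_inv μ := ext fun U => integral_ind μ U
  right_inv := integral_ofLinear

theorem equivLinear_apply (μ : FinMeasure k X V) : equivLinear μ = integral μ := rfl

theorem integral_pushforward [CompactSpace Y] (f : C(X, Y)) (μ : FinMeasure k X V)
    (φ : LocallyConstant Y k) : integral (pushforward f μ) φ = integral μ (φ.comap f) := by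
  rw [integral_eq_of_ind (pushforward f μ) (integral μ ∘ₗ LocallyConstant.comapₗ k f)]
  · rfl
  · intro U
    rw [LinearMap.comp_apply]
    exact (integral_ind μ (preimage f U)).symm

theorem integral_map (f : V →ₗ[k] W) (μ : FinMeasure k X V) (φ : LocallyConstant X k) :
    integral (map f μ) φ = f (integral μ φ) := by
  rw [integral_eq_of_ind (map f μ) (f ∘ₗ integral μ)]
  · rfl
  · intro U
    rw [LinearMap.comp_apply, integral_ind]
    rfl

theorem integral_point (x : X) (v : V) (φ : LocallyConstant X k) :
    integral (point k x v) φ = φ x • v := by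
  rw [integral_eq_of_ind (point k x v)
    (LinearMap.toSpanSingleton k V v ∘ₗ LocallyConstant.evalₗ k x)]
  · rfl
  · intro U
    rw [LinearMap.comp_apply, LinearMap.toSpanSingleton_apply]
    change _ = ind k U x • v
    by_cases h : x ∈ U
    · rw [ind_of_mem h, one_smul, point_apply_of_mem h]
    · rw [ind_of_notMem h, zero_smul, point_apply_of_notMem h]

theorem ext_integral {μ ν : FinMeasure k X V} (h : ∀ φ, integral μ φ = integral ν φ) : μ = ν :=
  equivLinear.injective (LinearMap.ext h)

end Integral

end FinMeasure

/-! ### Smooth representations of pro-p groups in characteristic p -/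

section SmoothRepresentation

variable {k Γ V : Type*} [Field k] [Group Γ] [AddCommGroup V] [Module k V]

theorem Representation.apply_apply_of_normal (ρ : Representation k Γ V) {N : Subgroup Γ}
    (hN : N.Normal) {v : V} (h : ∀ g ∈ N, ρ g v = v) (x : Γ) :
    ∀ g ∈ N, ρ g (ρ x v) = ρ x v := fun g hg => by
  have := h _ (hN.conj_mem g hg x⁻¹)
  conv_rhs => rw [← this]
  rw [← Module.End.mul_apply, ← Module.End.mul_apply, ← map_mul, ← map_mul]
  congr 2
  group

/-- The submodules of vectors killed by all `n`-fold products of the operators `ρ g - 1`. -/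
def Representation.unipotentFiltration (ρ : Representation k Γ V) : ℕ → Submodule k V
  | 0 => ⊥
  | n + 1 => ⨅ g, (unipotentFiltration ρ n).comap (ρ g - 1)

theorem Representation.mem_unipotentFiltration_succ {ρ : Representation k Γ V} {n : ℕ} {v : V} :
    v ∈ ρ.unipotentFiltration (n + 1) ↔ ∀ g, ρ g v - v ∈ ρ.unipotentFiltration n := by
  simp [unipotentFiltration]

theorem Representation.unipotentFiltration_mono (ρ : Representation k Γ V) :
    Monotone ρ.unipotentFiltration := by
  refine monotone_nat_of_le_succ fun n => ?_
  induction n with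
  | zero => exact bot_le
  | succ n ih =>
    intro v hv
    rw [mem_unipotentFiltration_succ] at hv ⊢
    exact fun g => ih (hv g)

variable [TopologicalSpace Γ]

/-- A representation is smooth if every vector is fixed by some open normal subgroup. -/
def Representation.IsSmooth (ρ : Representation k Γ V) : Prop :=
  ∀ v, ∃ N : Subgroup Γ, N.Normal ∧ IsOpen (N : Set Γ) ∧ ∀ g ∈ N, ρ g v = v

variable {p : ℕ} [Fact p.Prime]

theorem Representation.IsSmooth.finite_orbit (hΓ : IsProP p Γ) {ρ : Representation k Γ V}
    (hρ : ρ.IsSmooth) (v : V) :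
    (Set.range fun g => ρ g v).Finite := by
  obtain ⟨N, hN, hNo, h⟩ := hρ v
  obtain ⟨n, hn⟩ := hΓ.index_eq N hN hNo
  have : N.FiniteIndex := ⟨by rw [hn]; exact pow_ne_zero _ (Fact.out : p.Prime).ne_zero⟩
  refine (Set.finite_range (fun q : Γ ⧸ N => ρ q.out v)).subset ?_
  rintro _ ⟨g, rfl⟩
  refine ⟨(g : Γ ⧸ N), ?_⟩
  obtain ⟨x, hx⟩ := QuotientGroup.mk_out_eq_mul N g
  change ρ (Quotient.out _) v = _
  rw [hx, map_mul, Module.End.mul_apply, h _ x.2]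

/-- A nonzero smooth representation of a pro-`p` group in characteristic `p` has a nonzero fixed
vector, which can be chosen in the span of the orbit of any given nonzero vector. -/
theorem Representation.IsSmooth.exists_fixed [CharP k p] (hΓ : IsProP p Γ)
    {ρ : Representation k Γ V} (hρ : ρ.IsSmooth) {v : V} (hv : v ≠ 0) :
    ∃ v' ∈ Submodule.span k (Set.range fun g => ρ g v), v' ≠ 0 ∧ ∀ g, ρ g v' = v' := by
  -- The additive span of the finite orbit, not the `k`-span: it is finite even when `k` is
  -- infinite, so fixed points can be counted modulo `p`.
  let X := AddSubgroup.closure (Set.range fun g => ρ g v)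
  have hXρ : ∀ g, ∀ x ∈ X, ρ g x ∈ X := fun g x hx => by
    induction hx using AddSubgroup.closure_induction with
    | mem x hx =>
      obtain ⟨h, rfl⟩ := hx
      exact AddSubgroup.subset_closure ⟨g * h, by simp⟩
    | zero => rw [map_zero]; exact X.zero_mem
    | add x y _ _ hx hy => rw [map_add]; exact X.add_mem hx hy
    | neg x _ hx => rw [map_neg]; exact X.neg_mem hx
  have hp : ∀ x : V, p • x = 0 := fun x => by
    rw [← Nat.cast_smul_eq_nsmul k, CharP.cast_eq_zero, zero_smul]
  have hvX : v ∈ X := AddSubgroup.subset_closure ⟨1, by simp⟩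
  have hfin : Finite X := by
    have : AddGroup.FG X := (AddGroup.fg_iff_addSubgroup_fg X).2
      ⟨(hρ.finite_orbit hΓ v).toFinset, by rw [Set.Finite.coe_toFinset]⟩
    refine AddCommGroup.finite_of_fg_isAddTorsion _ fun x => ?_
    exact isOfFinAddOrder_iff_nsmul_eq_zero.2
      ⟨p, (Fact.out : p.Prime).pos, Subtype.ext (hp x)⟩
  have hcard : p ∣ Nat.card X := by
    have : addOrderOf (⟨v, hvX⟩ : X) = p :=
      addOrderOf_eq_prime (Subtype.ext (hp v)) fun h => hv (congrArg Subtype.val h)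
    rw [← this]
    exact addOrderOf_dvd_natCard _
  let _ : MulAction Γ X :=
    { smul g x := ⟨ρ g x, hXρ g x x.2⟩
      one_smul x := Subtype.ext (by change ρ 1 _ = _; simp)
      mul_smul g h x := Subtype.ext (by change ρ _ _ = ρ _ (ρ _ _); simp) }
  have hsmul : ∀ (g : Γ) (x : X), ((g • x : X) : V) = ρ g x := fun _ _ => rfl
  let φ := MulAction.toPermHom Γ X
  have := hΓ.isTopologicalGroup
  -- The kernel of the action on `X` contains the open stabilizer `N`, so its index is a power of
  -- `p`.
  have hpg : IsPGroup p φ.range := by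
    obtain ⟨N, hN, hNo, h⟩ := hρ v
    have hle : N ≤ φ.ker := fun g hg => by
      rw [MonoidHom.mem_ker]
      refine DFunLike.ext _ _ fun x => ?_
      refine Subtype.ext (?_ : ρ g x = x)
      obtain ⟨x, hx⟩ := x
      change ρ g x = x
      induction hx using AddSubgroup.closure_induction with
      | mem x hx =>
        obtain ⟨y, rfl⟩ := hx
        exact ρ.apply_apply_of_normal hN h y g hg
      | zero => rw [map_zero]
      | add x y _ _ hx hy => rw [map_add, hx, hy]
      | neg x _ hx => rw [map_neg, hx]
    obtain ⟨n, hn⟩ := hΓ.index_eq φ.ker inferInstance (Subgroup.isOpen_mono hle hNo)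
    exact IsPGroup.of_card (n := n) (by rw [← hn, Subgroup.index_ker])
  have h0 : (0 : X) ∈ MulAction.fixedPoints φ.range X := by
    rintro ⟨_, g, rfl⟩
    exact Subtype.ext (map_zero (ρ g))
  obtain ⟨b, hb, hb0⟩ := hpg.exists_fixed_point_of_prime_dvd_card_of_fixed_point X hcard h0
  refine ⟨b, ?_, fun h => hb0 (Subtype.ext h.symm), fun g => ?_⟩
  · have : X ≤ (Submodule.span k (Set.range fun g => ρ g v)).toAddSubgroup :=
      (AddSubgroup.closure_le _).2 Submodule.subset_span
    exact this b.2
  · exact congrArg Subtype.val (hb ⟨φ g, g, rfl⟩)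

/-- The relative version of `Representation.IsSmooth.exists_fixed`, modulo a subrepresentation. -/
theorem Representation.IsSmooth.exists_fixed_mod [CharP k p] (hΓ : IsProP p Γ)
    {ρ : Representation k Γ V} (hρ : ρ.IsSmooth) {W : Submodule k V}
    (hW : ∀ g, ∀ w ∈ W, ρ g w ∈ W) {v : V} (hv : v ∉ W) :
    ∃ v' ∈ Submodule.span k (Set.range fun g => ρ g v), v' ∉ W ∧ ∀ g, ρ g v' - v' ∈ W := by
  let σ : Representation k Γ (V ⧸ W) :=
    { toFun g := W.mapQ W (ρ g) (hW g)
      map_one' := by ext; simp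
      map_mul' g h := by ext; simp }
  have hσ : ∀ g x, σ g (W.mkQ x) = W.mkQ (ρ g x) := fun _ _ => rfl
  have hsm : σ.IsSmooth := fun q => by
    obtain ⟨x, rfl⟩ := W.mkQ_surjective q
    obtain ⟨N, hN, hNo, h⟩ := hρ x
    exact ⟨N, hN, hNo, fun g hg => by rw [hσ, h g hg]⟩
  obtain ⟨q, hq, hq0, hqf⟩ := hsm.exists_fixed hΓ (v := W.mkQ v)
    (by simpa using hv)
  have hr : (Set.range fun g => σ g (W.mkQ v)) = W.mkQ '' Set.range fun g => ρ g v := by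
    rw [← Set.range_comp]; rfl
  rw [hr, ← Submodule.map_span] at hq
  obtain ⟨v', hv', rfl⟩ := hq
  refine ⟨v', hv', fun h => hq0 (by simpa using h), fun g => ?_⟩
  rw [← Submodule.Quotient.mk_eq_zero, Submodule.Quotient.mk_sub, sub_eq_zero]
  exact hqf g

/-- Otherwise the quotient by the union of the filtration has a nonzero fixed vector, the class of
some `v'`. The differences `ρ g v' - v'` are finitely many, so they lie in one common step, and `v'`
lies in the next. -/
theorem Representation.IsSmooth.exists_mem_unipotentFiltration [CharP k p]
    (hΓ : IsProP p Γ) {ρ : Representation k Γ V} (hρ : ρ.IsSmooth) (v : V) :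
    ∃ n, v ∈ ρ.unipotentFiltration n := by
  have hmem : ∀ {x}, x ∈ ⨆ n, ρ.unipotentFiltration n ↔ ∃ n, x ∈ ρ.unipotentFiltration n :=
    Submodule.mem_iSup_of_directed _ ρ.unipotentFiltration_mono.directed_le
  by_contra hv
  rw [← hmem] at hv
  obtain ⟨v', -, hv', h⟩ := hρ.exists_fixed_mod hΓ (fun g w hw => by
    obtain ⟨n, hn⟩ := hmem.1 hw
    refine hmem.2 ⟨n, ?_⟩
    have := mem_unipotentFiltration_succ.1 (ρ.unipotentFiltration_mono n.le_succ hn) g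
    simpa using add_mem this hn) hv
  choose n hn using fun g => hmem.1 (h g)
  have hfin : (Set.range fun g => ρ g v').Finite := hρ.finite_orbit hΓ v'
  -- The level is indexed by the vector instead of the group element, since only the orbit is
  -- finite; off the orbit 0 is a dummy value.
  have hch : ∀ x : V, ∃ m, (∃ g, ρ g v' = x) → x - v' ∈ ρ.unipotentFiltration m := fun x => by
    by_cases hx : ∃ g, ρ g v' = x
    · obtain ⟨g, rfl⟩ := hx
      exact ⟨n g, fun _ => hn g⟩
    · exact ⟨0, fun h => (hx h).elim⟩
  choose m hm using hch
  refine hv' (hmem.2 ⟨hfin.toFinset.sup m + 1, mem_unipotentFiltration_succ.2 fun g => ?_⟩)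
  exact ρ.unipotentFiltration_mono (Finset.le_sup (f := m) (hfin.mem_toFinset.2 ⟨g, rfl⟩))
    (hm _ ⟨g, rfl⟩)

end SmoothRepresentation

/-! ### Locally constant functions and topological generators -/

section LocallyConstant

variable (k : Type*) {Γ : Type*} [Field k] [Group Γ] [TopologicalSpace Γ] [IsTopologicalGroup Γ]

/-- Left multiplication as a continuous map. -/
def leftMul (s : Γ) : C(Γ, Γ) := ⟨fun x => s * x, continuous_const_mul s⟩

/-- Right multiplication as a continuous map. -/
def rightMul (s : Γ) : C(Γ, Γ) := ⟨fun x => x * s, continuous_mul_const s⟩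

/-- The left regular representation on locally constant functions. -/
def leftRegular (Γ : Type*) [Group Γ] [TopologicalSpace Γ] [IsTopologicalGroup Γ] :
    Representation k Γ (LocallyConstant Γ k) where
  toFun g := LocallyConstant.comapₗ k (leftMul g⁻¹)
  map_one' := LinearMap.ext fun φ => LocallyConstant.ext fun x => congrArg φ (by simp [leftMul])
  map_mul' g h := LinearMap.ext fun φ => LocallyConstant.ext fun x =>
    congrArg φ (by simp [leftMul, mul_assoc])

variable {k}

theorem leftRegular_apply (g : Γ) (φ : LocallyConstant Γ k) (x : Γ) :
    leftRegular k Γ g φ x = φ (g⁻¹ * x) := rfl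

variable [CompactSpace Γ] [TotallyDisconnectedSpace Γ]

-- The pairs (g, x) with φ(g⁻¹x) ≠ φ(x) form a closed set; by compactness its projection to the
-- g-coordinate is closed, and it misses 1. An open normal subgroup fits in the complement.
variable (k Γ) in
theorem leftRegular_isSmooth : (leftRegular k Γ).IsSmooth := fun φ => by
  let C : Set (Γ × Γ) := {z | φ (z.1⁻¹ * z.2) = φ z.2}ᶜ
  have hC : IsClosed C := by
    have h : IsLocallyConstant fun z : Γ × Γ => φ (z.1⁻¹ * z.2) :=
      φ.isLocallyConstant.comp_continuous (continuous_fst.inv.mul continuous_snd)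
    exact ((h.prodMk (φ.isLocallyConstant.comp_continuous continuous_snd))
      {t | t.1 = t.2}).isClosed_compl
  have hU : IsOpen (Prod.fst '' C)ᶜ := (isClosedMap_fst_of_compactSpace _ hC).isOpen_compl
  obtain ⟨N, hN⟩ := ProfiniteGrp.exist_openNormalSubgroup_sub_open_nhds_of_one hU (by simp [C])
  refine ⟨N.toSubgroup, inferInstance, N.isOpen', fun g hg => LocallyConstant.ext fun x => ?_⟩
  by_contra h
  exact hN hg ⟨(g, x), h, rfl⟩

/-- In a topologically finitely generated pro-`p` group, any dense subgroup contains a finite set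
such that the locally constant functions invariant under it are constant. -/
theorem exists_finset_invariant_eq_const {p : ℕ} [Fact p.Prime] [CharP k p] (hΓ : IsProP p Γ)
    (hfg : IsTopFG Γ) (Γ' : Subgroup Γ) (hΓ' : Dense (Γ' : Set Γ)) :
    ∃ S : Finset Γ, (∀ s ∈ S, s ∈ Γ') ∧ ∀ φ : LocallyConstant Γ k,
      (∀ s ∈ S, ∀ x, φ (x * s) = φ x) → ∀ x, φ x = φ 1 := by
  classical
  obtain ⟨S₀, hS₀⟩ := hfg
  -- The continuous homomorphisms from Γ to the discrete group `k`, determined by their values on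
  -- the topological generators `S₀`.
  let B : Submodule k (LocallyConstant Γ k) :=
    { carrier := {χ | ∀ x y, χ (x * y) = χ x + χ y}
      zero_mem' := fun x y => by simp
      add_mem' := fun {a b} ha hb x y => by
        simp only [LocallyConstant.coe_add, Pi.add_apply, ha x y, hb x y]; abel
      smul_mem' := fun c a ha x y => by
        simp only [LocallyConstant.coe_smul, Pi.smul_apply, ha x y, smul_add] }
  have hB : ∀ χ ∈ B, (∀ s ∈ S₀, χ s = 0) → χ = 0 := fun χ hχ h => by
    have h1 : χ 1 = 0 := by simpa using hχ 1 1
    let K : Subgroup Γ :=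
      { carrier := {x | χ x = 0}
        one_mem' := h1
        mul_mem' := fun {x y} hx hy => by
          change χ _ = 0; rw [hχ, hx, hy, add_zero]
        inv_mem' := fun {x} hx => by
          have := hχ x x⁻¹
          rw [mul_inv_cancel, h1, hx, zero_add] at this
          exact this.symm }
    have hK : IsClosed (K : Set Γ) := χ.isLocallyConstant.isClosed_fiber 0
    have hle : Subgroup.closure (S₀ : Set Γ) ≤ K := (Subgroup.closure_le _).2 h
    have htop := hK.closure_subset_iff.2 hle
    rw [hS₀.closure_eq] at htop
    exact LocallyConstant.ext fun x => htop (Set.mem_univ x)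
  let res : B →ₗ[k] (S₀ → k) := LinearMap.pi fun s => LocallyConstant.evalₗ k s.1 ∘ₗ B.subtype
  have hres : Function.Injective res := (injective_iff_map_eq_zero res).2 fun χ h =>
    Subtype.ext (hB χ χ.2 fun s hs => congrFun h ⟨s, hs⟩)
  have hfd : Module.Finite k B := Module.Finite.of_injective res hres
  obtain ⟨F, hF⟩ := Module.Finite.iff_fg.1 hfd
  -- Agreeing with `s` on a finite spanning set of `B` is an open condition, so it can be met inside
  -- the dense subgroup.
  have hex : ∀ s : Γ, ∃ h ∈ Γ', ∀ χ ∈ B, χ h = χ s := fun s => by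
    have hopen : IsOpen (⋂ χ ∈ F, {x | χ x = χ s}) :=
      isOpen_biInter_finset fun χ _ => χ.isLocallyConstant.isOpen_fiber _
    obtain ⟨h, hhΓ, hh⟩ := hΓ'.exists_mem_open hopen ⟨s, by simp⟩
    refine ⟨h, hhΓ, fun χ hχ => ?_⟩
    rw [← hF] at hχ
    induction hχ using Submodule.span_induction with
    | mem χ hχ => exact Set.mem_iInter₂.1 hh χ hχ
    | zero => rfl
    | add a b _ _ ha hb => simp [ha, hb]
    | smul c a _ ha => simp [ha]
  choose h hhΓ hh using hex
  refine ⟨S₀.image h, ?_, fun φ hφ => ?_⟩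
  · intro s hs
    obtain ⟨t, -, rfl⟩ := Finset.mem_image.1 hs
    exact hhΓ t
  let A : Submodule k (LocallyConstant Γ k) :=
    { carrier := {φ | ∀ s ∈ S₀, ∀ x, φ (x * h s) = φ x}
      zero_mem' := fun _ _ _ => rfl
      add_mem' := fun ha hb s hs x => by simp [ha s hs x, hb s hs x]
      smul_mem' := fun c a ha s hs x => by simp [ha s hs x] }
  let W : Submodule k (LocallyConstant Γ k) :=
    { carrier := {φ | ∀ x, φ x = φ 1}
      zero_mem' := fun _ => rfl
      add_mem' := fun ha hb x => by simp [ha x, hb x]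
      smul_mem' := fun c a ha x => by simp [ha x] }
  by_contra hne
  obtain ⟨v, hv, hvW, hfix⟩ := (leftRegular_isSmooth k Γ).exists_fixed_mod hΓ (W := W)
    (fun g w hw x => by rw [leftRegular_apply, leftRegular_apply, hw, hw (_ * _)]) hne
  -- Left translations commute with right ones, so `v`, lying in the span of left translates of `φ`,
  -- inherits its right invariance.
  have hvA : v ∈ A := by
    refine (Submodule.span_le (p := A)).2 ?_ hv
    rintro _ ⟨g, rfl⟩ s hs x
    rw [leftRegular_apply, leftRegular_apply, ← mul_assoc]
    exact hφ _ (Finset.mem_image_of_mem h hs) _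
  -- Invariance of `v` modulo constants says that v(xy) − v(y) does not depend on y, hence equals
  -- v(x) − v(1).
  have hχ : v - LocallyConstant.const Γ (v 1) ∈ B := fun x y => by
    have := hfix x⁻¹ y
    simp only [LocallyConstant.coe_sub, Pi.sub_apply, leftRegular_apply, inv_inv, mul_one] at this
    simp only [LocallyConstant.coe_sub, Pi.sub_apply, LocallyConstant.coe_const,
      Function.const_apply]
    linear_combination this
  refine hvW fun x => ?_
  have h0 := hB _ hχ fun s hs => by
    rw [← hh s _ hχ]
    have := hvA s hs 1
    rw [one_mul] at this
    exact sub_eq_zero.2 this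
  exact sub_eq_zero.1 (LocallyConstant.congr_fun h0 x)

end LocallyConstant

/-! ### Contraactions and translations -/

namespace GContra

section Translation

variable {k : Type u} {G : Type v} [Field k] [Group G] [TopologicalSpace G] [IsTopologicalGroup G]
  (Q : GContra.{w} k G)

theorem π_point (g : G) (x : Q.V) : Q.π (FinMeasure.point k g x) = Q.rep g⁻¹ x := by
  change _ = Q.π (FinMeasure.point k g⁻¹⁻¹ x)
  rw [inv_inv]

/-- Contraassociativity for the image of `μ` under x ↦ (s, x): currying yields the measure B ↦
(point measure at s with value μ(B)), so `s` acts on the values, inside `Q.π`. -/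
theorem π_pushforward_leftMul (s : G) (μ : FinMeasure k G Q.V) :
    Q.π (FinMeasure.pushforward (leftMul s) μ) = Q.π (FinMeasure.map (Q.rep s⁻¹) μ) := by
  have h := Q.contraassoc (FinMeasure.pushforward
    ⟨fun x => (s, x), continuous_const.prodMk continuous_id⟩ μ)
  have h1 : FinMeasure.map Q.π (FinMeasure.curry (FinMeasure.pushforward
      ⟨fun x => (s, x), continuous_const.prodMk continuous_id⟩ μ)) =
      FinMeasure.map (Q.rep s⁻¹) μ := by
    refine FinMeasure.ext fun B => ?_
    change Q.π _ = Q.rep s⁻¹ (μ.1 B)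
    rw [← π_point]
    refine congrArg Q.π (FinMeasure.ext fun A => ?_)
    change μ.1 (FinMeasure.preimage _ (A ×ˢ B)) = _
    by_cases hA : s ∈ A
    · rw [FinMeasure.point_apply_of_mem hA]
      exact FinMeasure.apply_congr μ fun x => ⟨fun h => h.2, fun h => ⟨hA, h⟩⟩
    · rw [FinMeasure.point_apply_of_notMem hA, ← FinMeasure.apply_bot μ]
      exact FinMeasure.apply_congr μ fun x => ⟨fun h => (hA h.1).elim, fun h => h.elim⟩
  rw [h1] at h
  exact h

/-- With x ↦ (x, s) instead, currying yields the point measure at `s` with value `μ`, so `s` acts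
outside, on `Q.π μ`. -/
theorem π_pushforward_rightMul (s : G) (μ : FinMeasure k G Q.V) :
    Q.π (FinMeasure.pushforward (rightMul s) μ) = Q.rep s⁻¹ (Q.π μ) := by
  have h := Q.contraassoc (FinMeasure.pushforward
    ⟨fun x => (x, s), continuous_id.prodMk continuous_const⟩ μ)
  have h1 : FinMeasure.map Q.π (FinMeasure.curry (FinMeasure.pushforward
      ⟨fun x => (x, s), continuous_id.prodMk continuous_const⟩ μ)) =
      FinMeasure.point k s (Q.π μ) := by
    rw [← FinMeasure.map_point]
    refine congrArg _ (FinMeasure.ext fun B => FinMeasure.ext fun A => ?_)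
    change μ.1 (FinMeasure.preimage _ (A ×ˢ B)) = _
    by_cases hB : s ∈ B
    · rw [FinMeasure.point_apply_of_mem hB]
      exact FinMeasure.apply_congr μ fun x => ⟨fun h => h.1, fun h => ⟨h, hB⟩⟩
    · rw [FinMeasure.point_apply_of_notMem hB]
      change _ = (0 : Q.V)
      rw [← FinMeasure.apply_bot μ]
      exact FinMeasure.apply_congr μ fun x => ⟨fun h => (hB h.2).elim, fun h => h.elim⟩
  rw [h1, π_point] at h
  exact h

end Translation

end GContra

/-! ### The Nakayama lemma -/

section Nakayama

open FinMeasure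

variable {k : Type u} {Γ : Type v} [Field k] [Group Γ] [TopologicalSpace Γ] [IsTopologicalGroup Γ]
  [CompactSpace Γ] {E : Type*} [AddCommGroup E] [Module k E]

/-- The operator `∑ s ∈ S, (s - 1) ⊗ N s` on `E`-valued measures on a group. -/
def augmentationOperator (S : Finset Γ) (N : Γ → E →ₗ[k] E) :
    FinMeasure k Γ E →ₗ[k] FinMeasure k Γ E :=
  ∑ s ∈ S, (pushforward (leftMul s) ∘ₗ map (N s) - map (N s))

theorem integral_augmentationOperator (S : Finset Γ) (N : Γ → E →ₗ[k] E) (μ : FinMeasure k Γ E)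
    (φ : LocallyConstant Γ k) : integral (augmentationOperator S N μ) φ =
      ∑ s ∈ S, N s (integral μ (leftRegular k Γ s⁻¹ φ - φ)) := by
  rw [augmentationOperator, LinearMap.sum_apply, ← equivLinear_apply, map_sum, LinearMap.sum_apply]
  refine Finset.sum_congr rfl fun s _ => ?_
  rw [LinearMap.sub_apply, map_sub, LinearMap.sub_apply, equivLinear_apply, equivLinear_apply,
    LinearMap.comp_apply, integral_pushforward, integral_map, integral_map, ← map_sub, ← map_sub]
  congr 3
  exact LocallyConstant.ext fun x => congrArg φ (by simp [leftMul])

/-- Each application of the operator replaces the test function by differences of translates, which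
lie one step lower in the filtration. -/
theorem integral_augmentationOperator_pow_eq_zero (S : Finset Γ) (N : Γ → E →ₗ[k] E) {n : ℕ} :
    ∀ {φ : LocallyConstant Γ k}, φ ∈ (leftRegular k Γ).unipotentFiltration n →
      ∀ μ : FinMeasure k Γ E, integral ((augmentationOperator S N ^ n) μ) φ = 0 := by
  induction n with
  | zero =>
    intro φ hφ μ
    rw [(Submodule.mem_bot k).1 hφ, map_zero]
  | succ n ih =>
    intro φ hφ μ
    rw [pow_succ', Module.End.mul_apply, integral_augmentationOperator]
    refine Finset.sum_eq_zero fun s _ => ?_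
    rw [ih (Representation.mem_unipotentFiltration_succ.1 hφ s⁻¹), map_zero]

/-- On a pro-`p` group in characteristic `p`, the geometric series of an augmentation operator
converges. -/
theorem exists_eq_add_augmentationOperator [TotallyDisconnectedSpace Γ] {p : ℕ} [Fact p.Prime]
    [CharP k p] (hΓ : IsProP p Γ) (S : Finset Γ) (N : Γ → E →ₗ[k] E) (μ : FinMeasure k Γ E) :
    ∃ θ, θ = μ + augmentationOperator S N θ := by
  let a : ℕ → LocallyConstant Γ k →ₗ[k] E := fun n => integral ((augmentationOperator S N ^ n) μ)
  have ha : ∀ {m n φ}, φ ∈ (leftRegular k Γ).unipotentFiltration m → m ≤ n → a n φ = 0 :=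
    fun hφ hmn => integral_augmentationOperator_pow_eq_zero S N
      ((leftRegular k Γ).unipotentFiltration_mono hmn hφ) μ
  have hex := (leftRegular_isSmooth k Γ).exists_mem_unipotentFiltration hΓ
  have hsum : ∀ {m φ}, φ ∈ (leftRegular k Γ).unipotentFiltration m →
      ∑ᶠ n, a n φ = ∑ n ∈ Finset.range m, a n φ := fun hφ =>
    finsum_eq_sum_of_support_subset _ fun n hn => by
      by_contra h
      exact hn (ha hφ (by simpa using h))
  have hfin : ∀ φ, (Function.support fun n => a n φ).Finite := fun φ => by
    obtain ⟨m, hm⟩ := hex φ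
    refine (Finset.range m).finite_toSet.subset fun n hn => ?_
    by_contra h
    exact hn (ha hm (by simpa using h))
  -- The series ∑ Aⁿ μ, evaluated on each test function, has only finitely many nonzero terms.
  let Λ : LocallyConstant Γ k →ₗ[k] E :=
    { toFun φ := ∑ᶠ n, a n φ
      map_add' φ ψ := by
        simp only [map_add]
        exact finsum_add_distrib (hfin φ) (hfin ψ)
      map_smul' c φ := by
        simp only [map_smul, RingHom.id_apply]
        exact (smul_finsum' c (hfin φ)).symm }
  refine ⟨ofLinear Λ, ext_integral fun φ => ?_⟩
  obtain ⟨m, hm⟩ := hex φ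
  -- Raising the level by one puts the differences of `φ` in step `m`: the sum for `φ` has m + 1
  -- terms, of which n = 0 gives `μ` and the others match the m terms for the differences.
  have hm' := (leftRegular k Γ).unipotentFiltration_mono m.le_succ hm
  have hadd : ∀ ν ν' : FinMeasure k Γ E, integral (ν + ν') φ = integral ν φ + integral ν' φ :=
    fun ν ν' => LinearMap.congr_fun (map_add equivLinear ν ν') φ
  rw [hadd, integral_augmentationOperator, integral_ofLinear]
  change ∑ᶠ n, a n φ = _ + ∑ s ∈ S, N s (∑ᶠ n, a n _)
  rw [hsum hm', Finset.sum_range_succ', add_comm]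
  refine congrArg₂ (· + ·) rfl ?_
  simp only [hsum (Representation.mem_unipotentFiltration_succ.1 hm' _), map_sum]
  rw [Finset.sum_comm]
  refine Finset.sum_congr rfl fun n _ => ?_
  rw [← integral_augmentationOperator, ← Module.End.mul_apply, ← pow_succ']

/-- Nakayama lemma for contramodules over a pro-`p` group in characteristic `p`. -/
theorem GContra.eq_zero_of_eq_sum_rep_sub [TotallyDisconnectedSpace Γ] {p : ℕ} [Fact p.Prime]
    [CharP k p] (hΓ : IsProP p Γ) (Q : GContra.{w} k Γ) (S : Finset Γ) (N : Γ → E →ₗ[k] E)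
    (δ : E →ₗ[k] Q.V)
    (h : ∀ e, δ e = ∑ s ∈ S, (Q.rep s⁻¹ (δ (N s e)) - δ (N s e))) : δ = 0 := by
  refine LinearMap.ext fun e => ?_
  obtain ⟨θ, hθ⟩ := exists_eq_add_augmentationOperator hΓ S N (point k 1 e)
  -- Under `Q.π`, left translation by `s` becomes `Q.rep s⁻¹` on values, and then the hypothesis on
  -- `δ` applies value by value.
  have key : Q.π (map δ (augmentationOperator S N θ)) = Q.π (map δ θ) := by
    have h1 : map δ θ = ∑ s ∈ S, (map (Q.rep s⁻¹) (map δ (map (N s) θ)) - map δ (map (N s) θ)) :=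
      FinMeasure.ext fun U => by
        change δ (θ.1 U) = _
        rw [h, AddSubmonoidClass.coe_finsetSum, Finset.sum_apply]
        rfl
    conv_rhs => rw [h1]
    rw [augmentationOperator, LinearMap.sum_apply, map_sum, map_sum, map_sum]
    refine Finset.sum_congr rfl fun s _ => ?_
    rw [map_sub, ← Q.π_pushforward_leftMul, LinearMap.sub_apply, map_sub, map_sub]
    rfl
  have h2 := congrArg (fun μ => Q.π (map δ μ)) hθ
  simp only [map_add, key, map_point, Q.contraunit] at h2
  simpa using h2

end Nakayama

/-! ### Decomposition of measures and the compact case -/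

section Decomposition

open FinMeasure

variable {k : Type u} {Γ : Type v} [Field k] [Group Γ] [TopologicalSpace Γ] [IsTopologicalGroup Γ]
  [CompactSpace Γ] {V : Type*} [AddCommGroup V] [Module k V]

/-- If the locally constant functions invariant under right translations by `S` are constant, then
measures of total mass zero belong to the span of the augmentations `s - 1`, `s ∈ S`. -/
theorem exists_eq_point_add_sum (S : Finset Γ) (hS : ∀ φ : LocallyConstant Γ k,
      (∀ s ∈ S, ∀ x, φ (x * s) = φ x) → ∀ x, φ x = φ 1) :
    ∃ N : Γ → FinMeasure k Γ V →ₗ[k] FinMeasure k Γ V, ∀ μ,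
      μ = point k 1 (μ.1 ⊤) + ∑ s ∈ S, (pushforward (rightMul s) (N s μ) - N s μ) := by
  classical
  let R : Γ → LocallyConstant Γ k →ₗ[k] LocallyConstant Γ k := fun s =>
    LocallyConstant.comapₗ k (rightMul s) - LinearMap.id
  have hR : ∀ s φ x, R s φ x = φ (x * s) - φ x := fun _ _ _ => rfl
  let Ψ : LocallyConstant Γ k →ₗ[k] (S → LocallyConstant Γ k) × k :=
    (LinearMap.pi fun s : S => R s).prod (LocallyConstant.evalₗ k 1)
  have hΨφ : ∀ φ, Ψ φ = (fun s : S => R s φ, φ 1) := fun _ => rfl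
  have hΨ : LinearMap.ker Ψ = ⊥ := LinearMap.ker_eq_bot'.2 fun φ hφ => by
    rw [hΨφ, Prod.mk_eq_zero] at hφ
    refine LocallyConstant.ext fun x => ?_
    rw [hS φ fun s hs x => ?_, hφ.2]
    · rfl
    · rw [← sub_eq_zero, ← hR, congrFun hφ.1 ⟨s, hs⟩]
      rfl
  -- The components of a linear retraction of `Ψ` express φ as φ(1) plus a sum of `γ s` applied to
  -- the differences `R s φ`; the operators `N s` are dual to `γ s`.
  obtain ⟨g, hg⟩ := Ψ.exists_leftInverse_of_injective hΨ
  have hgφ : ∀ φ, g (fun s : S => R s φ, φ 1) = φ := LinearMap.congr_fun hg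
  let γ : Γ → LocallyConstant Γ k →ₗ[k] LocallyConstant Γ k := fun s =>
    if hs : s ∈ S then g ∘ₗ LinearMap.inl k _ _ ∘ₗ
      LinearMap.single k (fun _ : S => LocallyConstant Γ k) ⟨s, hs⟩ else 0
  have hone : g (0, 1) = 1 := by
    rw [← hgφ 1]
    refine congrArg g (Prod.ext (funext fun s => LocallyConstant.ext fun x => ?_) rfl)
    exact (sub_self (1 : k)).symm
  have hdec : ∀ φ : LocallyConstant Γ k, φ = φ 1 • 1 + ∑ s ∈ S, γ s (R s φ) := fun φ => by
    have hsum : ∑ s ∈ S, γ s (R s φ) = g (fun s : S => R s φ, 0) := by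
      have hsplit : ((fun s : S => R s φ, 0) : (S → LocallyConstant Γ k) × k) =
          LinearMap.inl k _ _ (∑ s : S, Pi.single s (R s φ)) := by
        rw [Finset.univ_sum_single]; rfl
      rw [hsplit, map_sum, map_sum, ← Finset.sum_coe_sort]
      refine Finset.sum_congr rfl fun s _ => ?_
      simp only [γ, dif_pos s.2]
      rfl
    rw [hsum, ← hone, ← map_smul, ← map_add]
    conv_lhs => rw [← hgφ φ]
    simp
  refine ⟨fun s => equivLinear.symm.toLinearMap ∘ₗ LinearMap.lcomp k V (γ s) ∘ₗ
    equivLinear.toLinearMap, fun μ => equivLinear.injective (LinearMap.ext fun φ => ?_)⟩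
  rw [map_add, map_sum, LinearMap.add_apply, LinearMap.sum_apply, equivLinear_apply,
    equivLinear_apply, integral_point, ← integral_ind (k := k) μ ⊤]
  have htop : ind k (⊤ : Clopens Γ) = 1 := LocallyConstant.ext fun x => ind_of_mem trivial
  conv_lhs => rw [hdec φ]
  rw [map_add, map_smul, htop, map_sum]
  refine congrArg _ (Finset.sum_congr rfl fun s _ => ?_)
  rw [map_sub equivLinear]
  change _ = integral (V := V) _ φ - integral (V := V) _ φ
  rw [integral_pushforward, ← map_sub]
  exact (LinearMap.congr_fun (integral_ofLinear (integral μ ∘ₗ γ s)) (R s φ)).symm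

/-- On a topologically finitely generated pro-`p` group, linear maps between contramodules
commuting with a dense subgroup commute with the contraactions. -/
theorem GContra.map_π_of_compact [TotallyDisconnectedSpace Γ] {p : ℕ} [Fact p.Prime]
    [CharP k p] (hΓ : IsProP p Γ) (hfg : IsTopFG Γ) (Γ' : Subgroup Γ) (hΓ' : Dense (Γ' : Set Γ))
    (P Q : GContra.{w} k Γ) (f : P.V →ₗ[k] Q.V) (hf : ∀ g ∈ Γ', ∀ x, f (P.rep g x) = Q.rep g (f x))
    (μ : FinMeasure k Γ P.V) : f (P.π μ) = Q.π (map f μ) := by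
  obtain ⟨S, hSΓ, hS⟩ := exists_finset_invariant_eq_const (k := k) hΓ hfg Γ' hΓ'
  obtain ⟨N, hN⟩ := exists_eq_point_add_sum (V := P.V) S hS
  let δ : FinMeasure k Γ P.V →ₗ[k] Q.V := f ∘ₗ P.π - Q.π ∘ₗ map f
  suffices δ = 0 from sub_eq_zero.1 (LinearMap.congr_fun this μ)
  refine Q.eq_zero_of_eq_sum_rep_sub hΓ S N δ fun ν => ?_
  conv_lhs => rw [hN ν]
  have h1 : δ (point k 1 (ν.1 ⊤)) = 0 := by
    change f _ - Q.π _ = 0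
    rw [map_point, P.contraunit, Q.contraunit, sub_self]
  rw [map_add, h1, zero_add, map_sum]
  refine Finset.sum_congr rfl fun s hs => ?_
  rw [map_sub]
  refine congrArg (· - _) ?_
  change f _ - Q.π (pushforward (rightMul s) (map f _)) = Q.rep s⁻¹ (f _ - Q.π _)
  rw [P.π_pushforward_rightMul, Q.π_pushforward_rightMul, hf _ (Γ'.inv_mem (hSΓ s hs)), map_sub]

end Decomposition

/-! ### From the open subgroup to the whole group -/

namespace FinMeasure

variable {k : Type*} {X V : Type*} [Field k] [TopologicalSpace X] [AddCommGroup V] [Module k V]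

/-- The restriction of a measure to a clopen subset. -/
def restrict (C : Clopens X) (μ : FinMeasure k X V) : FinMeasure k X V :=
  ⟨fun U => μ.1 (U ⊓ C), fun U W h => by
    change μ.1 ((U ⊔ W) ⊓ C) = _
    rw [inf_sup_right]
    exact μ.2.1 _ _ (h.mono inf_le_left inf_le_left), by
    obtain ⟨K, hK, h⟩ := μ.2.2
    exact ⟨K, hK, fun U hU => h _ (hU.mono_left Set.inter_subset_left)⟩⟩

theorem restrict_add_restrict_compl (C : Clopens X) (μ : FinMeasure k X V) :
    restrict C μ + restrict Cᶜ μ = μ := ext fun U => by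
  change μ.1 (U ⊓ C) + μ.1 (U ⊓ Cᶜ) = _
  rw [← μ.2.1, ← inf_sup_left, sup_compl_eq_top, inf_top_eq]
  exact (disjoint_compl_right.mono inf_le_right inf_le_right)

variable {Y : Type*} [TopologicalSpace Y] [CompactSpace Y]

/-- The restriction of a measure along an open embedding of a compact space into a Hausdorff
space. -/
def comapOpenEmbedding [T2Space X] (j : C(Y, X)) (hj : Topology.IsOpenEmbedding j)
    (μ : FinMeasure k X V) : FinMeasure k Y V :=
  ⟨fun U => μ.1 ⟨j '' U, (U.isClopen.isClosed.isCompact.image j.continuous).isClosed,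
      hj.isOpenMap _ U.isClopen.isOpen⟩, fun U W h => by
    rw [← μ.2.1]
    · exact apply_congr μ fun x => by
        change x ∈ j '' (U ∪ W : Set Y) ↔ x ∈ j '' U ∪ j '' W
        rw [Set.image_union]
    · rw [← Clopens.coe_disjoint] at h ⊢
      exact (Set.disjoint_image_iff hj.injective).2 h,
    Set.univ, isCompact_univ, fun U hU => by
      have : (U : Set Y) = ∅ := by simpa using hU
      rw [← apply_bot μ]
      exact apply_congr μ fun x => by
        change x ∈ j '' U ↔ x ∈ (∅ : Set X)
        rw [this, Set.image_empty]⟩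

theorem pushforward_comapOpenEmbedding [T2Space X] (j : C(Y, X)) (hj : Topology.IsOpenEmbedding j)
    (μ : FinMeasure k X V) (C : Clopens X) (hC : (C : Set X) = Set.range j) :
    pushforward j (comapOpenEmbedding j hj μ) = restrict C μ := ext fun U =>
  apply_congr μ fun x => by
    change x ∈ j '' (j ⁻¹' U) ↔ x ∈ (U ∩ C : Set X)
    rw [Set.image_preimage_eq_inter_range, hC]

end FinMeasure

namespace GContra

variable {k : Type u} {G : Type v} [Field k] [Group G] [TopologicalSpace G] [IsTopologicalGroup G]

/-- The inclusion of a subgroup as a continuous map. -/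
def incl (H : Subgroup G) : C(H, G) := ⟨Subtype.val, continuous_subtype_val⟩

/-- The restriction of a contramodule to a subgroup. -/
def restrictSubgroup (P : GContra.{w} k G) (H : Subgroup G) : GContra.{w} k H where
  V := P.V
  π := P.π ∘ₗ FinMeasure.pushforward (incl H)
  contraassoc ν := by
    have h := P.contraassoc (FinMeasure.pushforward
      ⟨fun z : H × H => ((z.1 : G), (z.2 : G)), by fun_prop⟩ ν)
    exact h
  contraunit x := P.contraunit x

/-- Linear maps between contramodules commuting with a dense subgroup commute with the
contraactions, provided that the group has a topologically finitely generated open pro-`p`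
subgroup. -/
theorem map_π_of_dense [T2Space G] {p : ℕ} [Fact p.Prime] [CharP k p] (H : Subgroup G)
    (hHo : IsOpen (H : Set G)) (hH : IsProP p H) (hfg : IsTopFG H) (G' : Subgroup G)
    (hG' : Dense (G' : Set G)) (P Q : GContra.{w} k G) (f : P.V →ₗ[k] Q.V)
    (hf : ∀ g ∈ G', ∀ x, f (P.rep g x) = Q.rep g (f x)) (μ : FinMeasure k G P.V) :
    f (P.π μ) = Q.π (FinMeasure.map f μ) := by
  classical
  have := hH.compactSpace
  have := hH.totallyDisconnectedSpace
  have hHd : Dense ((G'.subgroupOf H : Subgroup H) : Set H) :=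
    hG'.preimage hHo.isOpenEmbedding_subtypeVal.isOpenMap
  have hcompact : ∀ ν : FinMeasure k H P.V, f (P.π (FinMeasure.pushforward (incl H) ν)) =
      Q.π (FinMeasure.map f (FinMeasure.pushforward (incl H) ν)) := fun ν =>
    GContra.map_π_of_compact hH hfg _ hHd (P.restrictSubgroup H) (Q.restrictSubgroup H) f
      (fun g hg x => hf g hg x) ν
  -- The embedding of `H` onto the coset Hg.
  let j : G → C(H, G) := fun g => (rightMul g).comp (incl H)
  have hj : ∀ g, Topology.IsOpenEmbedding (j g) := fun g =>
    (Homeomorph.mulRight g).isOpenEmbedding.comp hHo.isOpenEmbedding_subtypeVal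
  let C : G → Clopens G := fun g => ⟨Set.range (j g),
    (isCompact_range (j g).continuous).isClosed, (hj g).isOpen_range⟩
  have hcoset : ∀ g ∈ G', ∀ ν : FinMeasure k G P.V, f (P.π (FinMeasure.restrict (C g) ν)) =
      Q.π (FinMeasure.map f (FinMeasure.restrict (C g) ν)) := fun g hg ν => by
    rw [← FinMeasure.pushforward_comapOpenEmbedding (j g) (hj g) ν (C g) rfl]
    generalize FinMeasure.comapOpenEmbedding (j g) (hj g) ν = ν'
    change f (P.π (FinMeasure.pushforward (rightMul g) (FinMeasure.pushforward (incl H) ν'))) =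
      Q.π (FinMeasure.pushforward (rightMul g)
        (FinMeasure.map f (FinMeasure.pushforward (incl H) ν')))
    rw [π_pushforward_rightMul, π_pushforward_rightMul, hf _ (G'.inv_mem hg), hcompact]
  -- Induction on the cosets carrying `ν`: restricting to the complement of `C g` removes one of
  -- them, even if representatives repeat a coset.
  have hfinite : ∀ (T : Finset G), (∀ g ∈ T, g ∈ G') → ∀ ν : FinMeasure k G P.V,
      (∀ U : Clopens G, (∀ g ∈ T, Disjoint U (C g)) → ν.1 U = 0) →
      f (P.π ν) = Q.π (FinMeasure.map f ν) := fun T => by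
    induction T using Finset.induction_on with
    | empty =>
      intro _ ν hν
      have : ν = 0 := FinMeasure.ext fun U => hν U (by simp)
      rw [this, map_zero, map_zero, map_zero, map_zero]
    | insert g T _ ih =>
      intro hT ν hν
      rw [← FinMeasure.restrict_add_restrict_compl (C g) ν, map_add, map_add, map_add, map_add,
        hcoset g (hT g (Finset.mem_insert_self g T)),
        ih (fun g' hg' => hT g' (Finset.mem_insert_of_mem hg')) (FinMeasure.restrict (C g)ᶜ ν)]
      refine fun U hU => hν _ fun g' hg' => ?_
      rcases Finset.mem_insert.1 hg' with rfl | hg'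
      · exact disjoint_compl_left.mono_left inf_le_right
      · exact (hU g' hg').mono_left inf_le_left
  obtain ⟨K, hK, hμ⟩ := μ.2.2
  have hcover : K ⊆ ⋃ g : G', (C g : Set G) := fun x _ => by
    -- This open set is the coset Hx, so density provides a representative of it in `G'`.
    obtain ⟨g, hg, hgx⟩ := hG'.exists_mem_open (U := {y | x * y⁻¹ ∈ (H : Set G)})
      (hHo.preimage (by fun_prop)) ⟨x, by simp⟩
    exact Set.mem_iUnion.2 ⟨⟨g, hg⟩, ⟨x * g⁻¹, hgx⟩, inv_mul_cancel_right x g⟩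
  obtain ⟨T, hT⟩ := hK.elim_finite_subcover _ (fun g : G' => (C g).isClopen.isOpen) hcover
  refine hfinite (T.image Subtype.val) ?_ μ fun U hU => hμ U ?_
  · intro g hg
    obtain ⟨g, -, rfl⟩ := Finset.mem_image.1 hg
    exact g.2
  · rw [Set.disjoint_left]
    intro x hxU hxK
    obtain ⟨g, hg, hx⟩ := Set.mem_iUnion₂.1 (hT hxK)
    exact Set.disjoint_left.1 (Clopens.coe_disjoint.2 (hU g (Finset.mem_image_of_mem _ hg))) hxU hx

end GContra

end

theorem mainTheorem3 (p : ℕ) [Fact p.Prime] (k : Type u) [Field k] [CharP k p]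
    (G : Type v) [Group G] [TopologicalSpace G] [IsTopologicalGroup G]
    [LocallyCompactSpace G] [T2Space G] [TotallyDisconnectedSpace G]
    (H : Subgroup G) (hH_open : IsOpen (H : Set G)) (hH_compact : IsCompact (H : Set G))
    (hH_pro : IsProP p H) (hH_fg : IsTopFG H) :
    ((GContra.forget.{w} k G).Full ∧ (GContra.forget.{w} k G).Faithful) ∧
    ∀ G' : Subgroup G, Dense (G' : Set G) →
      (GContra.forget.{w} k G ⋙ Rep.resFunctor G'.subtype).Full ∧
      (GContra.forget.{w} k G ⋙ Rep.resFunctor G'.subtype).Faithful := by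
  have hfaithful : (GContra.forget.{w} k G).Faithful := ⟨fun {P Q f g} h =>
    GContra.Hom.ext (LinearMap.ext fun x =>
      congrArg (fun φ : (GContra.forget.{w} k G).obj P ⟶ (GContra.forget.{w} k G).obj Q =>
        φ.hom x) h)⟩
  refine ⟨⟨⟨fun {P Q} φ => ?_⟩, hfaithful⟩, fun G' hG' => ⟨⟨fun {P Q} φ => ?_⟩, inferInstance⟩⟩
  · refine ⟨⟨φ.hom.toLinearMap, GContra.map_π_of_dense H hH_open hH_pro hH_fg ⊤ dense_univ P Q _
      fun g _ x => ?_⟩, rfl⟩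
    exact LinearMap.congr_fun (φ.hom.2 g) x
  · refine ⟨⟨φ.hom.toLinearMap, GContra.map_π_of_dense H hH_open hH_pro hH_fg G' hG' P Q _
      fun g hg x => ?_⟩, rfl⟩
    exact LinearMap.congr_fun (φ.hom.2 ⟨g, hg⟩) x
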